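/- Let $A$ be a semisimple, commutative, unital complex Banach algebra, and let $M(A)$ be its character space (the set of non-zero multiplicative linear functionals on $A$) with the Gelfand topology, i.e. the relative weak-$*$ topology. Regard $A$ as a Banach function algebra on $M(A)$ by identifying each $f\in A$ with its Gelfand transform, $f(x)=x(f)$ for $x\in M(A)$. For $E\subseteq M(A)$ let $I_A(E)=\{f\in A: f\equiv 0 \text{ on } E\}$. The set $E$ is called hull-kernel closed if $E=\{x\in M(A): f(x)=0 \text{ for all } f\in I_A(E)\}$, and $t$-analytic for $A$ if, for every $f\in A$ and every nonempty relatively open subset $U$ of $E$, $f\equiv 0$ on $U$ implies $f\equiv 0$ on $E$. If $E\subseteq M(A)$ is hull-kernel closed and $t$-analytic for $A$, then $E$ is connected in the Gelfand topology, that is, $E$ is not the union of two disjoint nonempty relatively open subsets (so the empty set counts as connected). -/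

import Mathlib

namespace BanachFunctionAlgebra

open WeakDual

variable {A : Type*} [NormedCommRing A] [NormedAlgebra ℂ A]

/-- The zero set `Z(f)` in the character space `M(A)` of an element `f` of `A`, regarded as a
function on `M(A)` through its Gelfand transform `φ ↦ φ f`. -/
def zeroSet (f : A) : Set (characterSpace ℂ A) :=
  {φ | gelfandTransform ℂ A f φ = 0}

/-- The hull `Z(J)` of an ideal `J`: the set of common zeros of the elements of `J`. -/
def hull (J : Ideal A) : Set (characterSpace ℂ A) :=
  ⋂ f ∈ J, zeroSet f

/-- The kernel `I(E)` of a subset `E` of `M(A)`: the ideal of all elements of `A` whose Gelfand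
transform vanishes identically on `E`. -/
def kernel (E : Set (characterSpace ℂ A)) : Ideal A where
  carrier := {f | ∀ φ ∈ E, gelfandTransform ℂ A f φ = 0}
  add_mem' := by
    intro f g hf hg φ hφ
    simp only [map_add, ContinuousMap.add_apply, hf φ hφ, hg φ hφ, add_zero]
  zero_mem' := by
    intro φ _
    simp only [map_zero, ContinuousMap.zero_apply]
  smul_mem' := by
    intro c f hf φ hφ
    simp only [smul_eq_mul, map_mul, ContinuousMap.mul_apply, hf φ hφ, mul_zero]

/-- A subset `E` of `M(A)` is hull-kernel closed if it equals the hull of its kernel; these are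
by definition the closed sets of the hull-kernel topology on `M(A)`. -/
def IsHullKernelClosed (E : Set (characterSpace ℂ A)) : Prop :=
  E = hull (kernel E)

/-- A subset `E` of `M(A)` is `t`-analytic for `A` if every `f` in `A` that vanishes on some
nonempty subset `U` of `E`, relatively open in `E` for the Gelfand topology, vanishes on `E`. -/
def IsTAnalytic (E : Set (characterSpace ℂ A)) : Prop :=
  ∀ (f : A) (U : Set (characterSpace ℂ A)),
    (∃ V : Set (characterSpace ℂ A), IsOpen V ∧ U = V ∩ E) → U.Nonempty →
      (∀ φ ∈ U, gelfandTransform ℂ A f φ = 0) → ∀ φ ∈ E, gelfandTransform ℂ A f φ = 0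

end BanachFunctionAlgebra

open MeasureTheory Set Filter Topology

namespace BanachFunctionAlgebra

/-! A separation of `E` gives a `{0, 1}`-valued function `σ`, continuous on `E`. Since `E` is the
hull of its kernel, a Shilov idempotent argument (`exists_gelfand_eq_of_continuousOn`) makes `σ`
agree on `E` with the Gelfand transform of some `a`. This `a` vanishes on one piece, hence on all of
`E` by `t`-analyticity, yet it equals `1` on the other piece.

The Shilov step uses only one complex variable. It suffices to approximate `σ` within 1/16
(`exists_approx`), since a Riesz projection then makes the values exact. If no approximation exists,
Zorn gives an ideal `J` maximal among the failures. Some `f` is not scalar modulo `J`, as otherwise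
the hull of `J` has at most one point. Every `J + (f - w)` is then strictly larger, so `σ` is
approximable on each level set of `f`.

`exists_approx_of_forall_level` glues these local approximants. A partition of unity gives a smooth
`g : ℂ → A` with `φ (g (φ f))` near `σ φ`. Composing with a polynomial `P` flat at 0 and 1 makes the
`∂/∂\bar z` derivative nearly divisible by `f - w` modulo `J`, with continuous quotient `m`. By
Cauchy–Pompeiu, `π⁻¹ ∫ m` approximates `σ` on the whole hull. -/

/-! ### Polynomials flat at 0 and 1. -/

/-- Polynomials vanishing at `0`, equal to `1` at `1`, and flat near both points. -/
theorem exists_flat_step (N : ℕ) : ∃ (P : ℂ → ℂ) (c : ℝ), P 0 = 0 ∧ P 1 = 1 ∧ 0 < c ∧ c ≤ 6 ^ N ∧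
    ∀ z, HasDerivAt P (c * (z - z ^ 2) ^ N) z := by
  induction N with
  | zero => exact ⟨id, 1, rfl, rfl, by simp, by simp, fun z => by simpa using hasDerivAt_id z⟩
  | succ N ih =>
    obtain ⟨P, c, h0, h1, hc, hc6, hd⟩ := ih
    have hN : (0 : ℝ) < N + 1 := by positivity
    have hN' : (N + 1 : ℂ) ≠ 0 := by exact_mod_cast hN.ne'
    -- Integration by parts: the added term vanishes at 0 and 1, and `(2z - 1)² = 1 - 4(z - z²)`
    -- trades exponent `N` for `N + 1`. The factor `(4N + 6) / (N + 1)` is at most 6.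
    refine ⟨fun z => P z + c / (N + 1) * ((z - z ^ 2) ^ (N + 1) * (2 * z - 1)),
      c * (4 * N + 6) / (N + 1), by simp [h0], by simp [h1], by positivity, ?_, fun z => ?_⟩
    · rw [div_le_iff₀ hN, pow_succ]
      have : (0 : ℝ) ≤ N := N.cast_nonneg
      calc c * (4 * N + 6) ≤ 6 ^ N * (6 * (N + 1)) := by gcongr; linarith
        _ = _ := by ring
    · have hy : HasDerivAt (fun z : ℂ => z - z ^ 2) (1 - 2 * z) z := by
        exact ((hasDerivAt_id z).sub (hasDerivAt_pow 2 z)).congr_deriv (by simp)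
      have hl : HasDerivAt (fun z : ℂ => 2 * z - 1) 2 z := by
        exact (((hasDerivAt_id z).const_mul 2).sub_const 1).congr_deriv (by simp)
      refine ((hd z).add (((hy.pow (N + 1)).mul hl).const_mul (c / (N + 1) : ℂ))).congr_deriv ?_
      push_cast
      simp only [Pi.pow_apply]
      field_simp
      ring

/-- Near 0 and 1 one has `‖z - z²‖ ≤ 1/8`, so `‖P'‖ ≤ 6^N / 8^N`; then the mean value inequality
applies. -/
theorem norm_step_le {P : ℂ → ℂ} {c : ℝ} {N : ℕ} (hc : 0 < c) (hc6 : c ≤ 6 ^ N)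
    (hP : ∀ z, HasDerivAt P (c * (z - z ^ 2) ^ N) z) {s z : ℂ} (hPs : P s = s)
    (hs : s = 0 ∨ s = 1) (hz : ‖z - s‖ < 1 / 16) : ‖P z - s‖ ≤ (3 / 4) ^ N := by
  have key := (convex_ball s (1 / 16)).norm_image_sub_le_of_norm_hasDerivWithin_le
    (f := P) (C := (3 / 4) ^ N) (fun x _ => (hP x).hasDerivWithinAt) (fun x hx => ?_)
    (Metric.mem_ball_self (by norm_num)) (show z ∈ Metric.ball s (1 / 16) by
      rwa [mem_ball_iff_norm])
  · rw [hPs] at key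
    refine key.trans (mul_le_of_le_one_right (by positivity) (by linarith))
  · rw [mem_ball_iff_norm] at hx
    have h8 : ‖x - x ^ 2‖ ≤ 1 / 8 := by
      have e : x - x ^ 2 = (x - s) * (1 - 2 * s) - (x - s) * (x - s) := by
        rcases hs with rfl | rfl <;> ring
      have h1 : ‖(1 - 2 * s : ℂ)‖ = 1 := by rcases hs with rfl | rfl <;> norm_num
      rw [e]
      refine (norm_sub_le _ _).trans ?_
      rw [norm_mul, norm_mul, h1]
      nlinarith [norm_nonneg (x - s)]
    rw [norm_mul, norm_pow, Complex.norm_real, Real.norm_of_nonneg hc.le]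
    calc c * ‖x - x ^ 2‖ ^ N ≤ 6 ^ N * (1 / 8) ^ N := by gcongr
      _ = _ := by rw [← mul_pow]; norm_num

/-! ### Approximate Cauchy–Pompeiu formula. -/

/-- An approximate form of the Cauchy–Pompeiu formula for compactly supported functions. -/
theorem norm_pi_mul_sub_integral_le {h F : ℂ → ℂ} {R δ C : ℝ} {z : ℂ} (hh : ContDiff ℝ 1 h)
    (hsupp : ∀ w, R < ‖w‖ → h w = 0) (hF : StronglyMeasurable F) (hFC : ∀ w, ‖F w‖ ≤ C)
    (hFs : ∀ w, R < ‖w‖ → F w = 0) (hR : 0 < R) (hz : ‖z‖ ≤ R)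
    (hδ : ∀ w, ‖1 / 2 * (fderiv ℝ h w 1 + Complex.I * fderiv ℝ h w Complex.I) - (z - w) * F w‖ ≤ δ) :
    ‖Real.pi * h z - ∫ w, F w‖ ≤ δ * (2 * Real.pi * (2 * R + 1)) := by
  have hpi := Real.pi_pos
  -- A segment of length `L` from `z` ends outside the disc of radius `R`, where `h` and `F` vanish.
  set L : ℝ := 2 * R + 1 with hL
  set e : ℝ → ℂ := fun θ => Real.cos θ + Real.sin θ * Complex.I with he
  have hen : ∀ θ, ‖e θ‖ = 1 := fun θ => by
    simp only [he, Complex.ofReal_cos, Complex.ofReal_sin, Complex.norm_cos_add_sin_mul_I]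
  have hec : Continuous e := by fun_prop
  have hed : ∀ θ, HasDerivAt e (Complex.I * e θ) θ := fun θ => by
    have h1 := (Real.hasDerivAt_cos θ).ofReal_comp
    have h2 := ((Real.hasDerivAt_sin θ).ofReal_comp).mul_const Complex.I
    refine (h1.add h2).congr_deriv ?_
    simp only [he]
    push_cast
    linear_combination (-Complex.sin θ) * Complex.I_sq
  set D := fderiv ℝ h with hD
  have hDc : Continuous D := hh.continuous_fderiv one_ne_zero
  have hhd : ∀ w, HasFDerivAt h (D w) w := fun w => (hh.differentiable one_ne_zero w).hasFDerivAt
  set T : Set (ℝ × ℝ) := Ioc 0 L ×ˢ Ioc (-Real.pi) Real.pi with hT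
  set γ : ℝ × ℝ → ℂ := fun p => z + p.1 * e p.2 with hγ
  have hγc : Continuous γ := by fun_prop
  set Φ₁ : ℝ × ℝ → ℂ := fun p => D (γ p) (e p.2) with hΦ₁
  set Φ₂ : ℝ × ℝ → ℂ := fun p => D (γ p) (Complex.I * e p.2) with hΦ₂
  have hΦ₁c : Continuous Φ₁ := (hDc.comp hγc).clm_apply (by fun_prop)
  have hΦ₂c : Continuous Φ₂ := (hDc.comp hγc).clm_apply (by fun_prop)
  have hTvol : volume T = ENNReal.ofReal (L * (2 * Real.pi)) := by
    rw [hT, Measure.volume_eq_prod, Measure.prod_prod, Real.volume_Ioc, Real.volume_Ioc,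
      ← ENNReal.ofReal_mul (by linarith)]
    congr 1; ring
  have hTfin : volume T < ⊤ := by rw [hTvol]; exact ENNReal.ofReal_lt_top
  have hTm : MeasurableSet T := measurableSet_Ioc.prod measurableSet_Ioc
  have hTK : T ⊆ Icc 0 L ×ˢ Icc (-Real.pi) Real.pi :=
    prod_mono Ioc_subset_Icc_self Ioc_subset_Icc_self
  have hint : ∀ {Φ : ℝ × ℝ → ℂ}, Continuous Φ → IntegrableOn Φ T := fun hΦ =>
    (hΦ.continuousOn.integrableOn_compact (isCompact_Icc.prod isCompact_Icc)).mono_set hTK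
  -- radial integral
  have h₁ : ∫ p in T, Φ₁ p = -(2 * Real.pi * h z) := by
    have hsw : ∫ p in T, Φ₁ p = ∫ θ in Ioc (-Real.pi) Real.pi, ∫ r in Ioc 0 L, Φ₁ (r, θ) := by
      have h1 := setIntegral_prod Φ₁ (s := Ioc 0 L) (t := Ioc (-Real.pi) Real.pi)
        (μ := volume) (ν := volume) (hint hΦ₁c)
      rw [← Measure.volume_eq_prod] at h1
      rw [h1]
      refine integral_integral_swap ?_
      rw [Measure.prod_restrict, ← Measure.volume_eq_prod]
      exact hint hΦ₁c
    rw [hsw]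
    have : ∀ θ, ∫ r in Ioc 0 L, Φ₁ (r, θ) = -h z := fun θ => by
      rw [← intervalIntegral.integral_of_le (by linarith)]
      have hd : ∀ r ∈ uIcc 0 L, HasDerivAt (fun r : ℝ => h (γ (r, θ))) (Φ₁ (r, θ)) r := by
        intro r _
        refine (hhd (γ (r, θ))).comp_hasDerivAt r ?_
        simpa [hγ] using ((hasDerivAt_id r).ofReal_comp.mul_const (e θ)).const_add z
      rw [intervalIntegral.integral_eq_sub_of_hasDerivAt hd
        ((hΦ₁c.comp (by fun_prop : Continuous fun r : ℝ => (r, θ))).intervalIntegrable _ _)]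
      have : h (γ (L, θ)) = 0 := by
        apply hsupp
        have : ‖(L : ℂ) * e θ‖ ≤ ‖z + L * e θ‖ + ‖z‖ := by
          simpa using norm_sub_le (z + L * e θ) z
        rw [norm_mul, hen, Complex.norm_real, Real.norm_of_nonneg (by linarith)] at this
        simp only [hγ]; linarith
      rw [this]; simp [hγ]
    simp only [this]
    rw [setIntegral_const, Measure.real, Real.volume_Ioc, ENNReal.toReal_ofReal (by linarith)]
    simp only [sub_neg_eq_add, Complex.real_smul]
    push_cast
    ring
  -- angular integral
  have h₂ : ∫ p in T, Φ₂ p = 0 := by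
    have h1 := setIntegral_prod Φ₂ (s := Ioc 0 L) (t := Ioc (-Real.pi) Real.pi)
        (μ := volume) (ν := volume) (hint hΦ₂c)
    rw [← Measure.volume_eq_prod] at h1
    rw [h1]
    refine setIntegral_eq_zero_of_forall_eq_zero fun r hr => ?_
    rw [← intervalIntegral.integral_of_le (by linarith)]
    have hr0 : (r : ℂ) ≠ 0 := by exact_mod_cast hr.1.ne'
    have hd : ∀ θ ∈ uIcc (-Real.pi) Real.pi,
        HasDerivAt (fun θ : ℝ => (r : ℂ)⁻¹ * h (γ (r, θ))) (Φ₂ (r, θ)) θ := by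
      intro θ _
      have h3 : HasDerivAt (fun θ : ℝ => γ (r, θ)) (r * (Complex.I * e θ)) θ :=
        ((hed θ).const_mul (r : ℂ)).const_add z
      refine (((hhd (γ (r, θ))).comp_hasDerivAt θ h3).const_mul (r : ℂ)⁻¹).congr_deriv ?_
      rw [show (r : ℂ) * (Complex.I * e θ) = r • (Complex.I * e θ) by simp, map_smul]
      simp [hΦ₂, hr0]
    rw [intervalIntegral.integral_eq_sub_of_hasDerivAt hd
      ((hΦ₂c.comp (by fun_prop : Continuous fun θ : ℝ => (r, θ))).intervalIntegrable _ _)]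
    simp [hγ, he]
  set G : ℝ × ℝ → ℂ := fun p => p.1 • F (γ p) with hG
  have hGint : IntegrableOn G T := by
    refine Measure.integrableOn_of_bounded (M := L * C) hTfin.ne ?_ ?_
    · exact (measurable_fst.stronglyMeasurable.smul
        (hF.comp_measurable hγc.measurable)).aestronglyMeasurable
    · refine (ae_restrict_iff' hTm).2 (Eventually.of_forall fun p hp => ?_)
      rw [hG, norm_smul, Real.norm_of_nonneg hp.1.1.le]
      exact mul_le_mul hp.1.2 (hFC _) (norm_nonneg _) (by linarith)
  have h₃ : ∫ w, F w = ∫ p in T, G p := by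
    rw [← integral_add_left_eq_self F z,
      ← Complex.integral_comp_polarCoord_symm (fun w => F (z + w))]
    simp only [Complex.polarCoord_symm_apply]
    have ae : (Ioi (0 : ℝ) ×ˢ Ioo (-Real.pi) Real.pi : Set (ℝ × ℝ)) =ᵐ[volume]
        (Ioi (0 : ℝ) ×ˢ Ioc (-Real.pi) Real.pi : Set (ℝ × ℝ)) := by
      rw [Measure.volume_eq_prod]
      exact Measure.set_prod_ae_eq (ae_eq_refl _) Ioo_ae_eq_Ioc
    rw [show polarCoord.target = Ioi (0 : ℝ) ×ˢ Ioo (-Real.pi) Real.pi from rfl,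
      setIntegral_congr_set ae]
    refine setIntegral_eq_of_subset_of_forall_sdiff_eq_zero
      (measurableSet_Ioi.prod measurableSet_Ioc)
      (prod_mono (fun x hx => hx.1) subset_rfl) ?_
    rintro ⟨r, θ⟩ ⟨⟨hr, hθ⟩, hnot⟩
    have hrL : L < r := by
      by_contra hle
      exact hnot ⟨⟨hr, not_lt.1 hle⟩, hθ⟩
    have : F (z + r * e θ) = 0 := by
      apply hFs
      have : ‖(r : ℂ) * e θ‖ ≤ ‖z + r * e θ‖ + ‖z‖ := by
        simpa using norm_sub_le (z + r * e θ) z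
      rw [norm_mul, hen, Complex.norm_real, Real.norm_of_nonneg (by linarith)] at this
      linarith
    simp only [he] at this
    simp only [this, smul_zero]
  -- In polar coordinates about `z` the area factor `r` cancels the singularity of `1 / (z - w)`:
  -- the integrand is a unimodular factor times the quantity bounded by `δ`.
  have h₄ : (Real.pi : ℂ) * h z - ∫ w, F w
      = -∫ p in T, (G p + (1 / 2 * Φ₁ p + 1 / 2 * Complex.I * Φ₂ p)) := by
    rw [integral_add hGint (hint (by fun_prop)),
      integral_add (hint (by fun_prop)) (hint (by fun_prop)), integral_const_mul,
      integral_const_mul, h₁, h₂, h₃]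
    ring
  rw [h₄, norm_neg]
  refine (norm_setIntegral_le_of_norm_le_const hTfin (C := δ) ?_).trans (le_of_eq ?_)
  · rintro ⟨r, θ⟩ hp
    have hlin : ∀ v : ℂ, D (γ (r, θ)) v
        = v.re * D (γ (r, θ)) 1 + v.im * D (γ (r, θ)) Complex.I := fun v => by
      conv_lhs => rw [show v = v.re • (1 : ℂ) + v.im • Complex.I by simp [Complex.re_add_im]]
      rw [map_add, map_smul, map_smul]
      simp
    have hconj : (starRingEnd ℂ (e θ)) * e θ = 1 := by
      rw [← Complex.normSq_eq_conj_mul_self, Complex.normSq_eq_norm_sq, hen]; simp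
    have hc : starRingEnd ℂ (e θ) = Real.cos θ - Real.sin θ * Complex.I := by
      simp only [he, map_add, map_mul, Complex.conj_ofReal, Complex.conj_I]; ring
    have e1 : G (r, θ) + (1 / 2 * Φ₁ (r, θ) + 1 / 2 * Complex.I * Φ₂ (r, θ))
        = starRingEnd ℂ (e θ) * (1 / 2 * (D (γ (r, θ)) 1 + Complex.I * D (γ (r, θ)) Complex.I)
          - (z - γ (r, θ)) * F (γ (r, θ))) := by
      have e2 : z - γ (r, θ) = -(r * e θ) := by simp [hγ]
      have e3 : G (r, θ) = r * F (γ (r, θ)) := by simp [hG]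
      have er : (e θ).re = Real.cos θ := by simp [he, -Complex.ofReal_cos, -Complex.ofReal_sin]
      have ei : (e θ).im = Real.sin θ := by simp [he, -Complex.ofReal_cos, -Complex.ofReal_sin]
      have er' : (Complex.I * e θ).re = -Real.sin θ := by
        simp [ei]
      have ei' : (Complex.I * e θ).im = Real.cos θ := by
        simp [er]
      rw [e2, e3]
      simp only [hΦ₁, hΦ₂]
      rw [hlin (e θ), hlin (Complex.I * e θ), er, ei, er', ei']
      have : starRingEnd ℂ (e θ) * (-(r * e θ)) = -r := by linear_combination (-r : ℂ) * hconj
      rw [mul_sub, ← mul_assoc (starRingEnd ℂ (e θ)) (-(r * e θ)), this, hc]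
      push_cast
      linear_combination ((1 / 2) * Complex.sin θ * D (γ (r, θ)) Complex.I) * Complex.I_sq
    rw [e1, norm_mul, RCLike.norm_conj, hen, one_mul]
    exact hδ _
  · rw [Measure.real, hTvol, ENNReal.toReal_ofReal (by positivity)]
    ring

/-! ### Hulls, quotients and powers small modulo an ideal. -/

open WeakDual

/-- `a ^ (n * q) - (a ^ n - j) ^ q` is a multiple of `j`. -/
theorem exists_norm_pow_mul_sub_lt {A : Type*} [NormedCommRing A] {J : Ideal A} {a : A} {ρ : ℝ} {n : ℕ}
    (h : ∃ j ∈ J, ‖a ^ n - j‖ < ρ ^ n) {q : ℕ} (hq : 1 ≤ q) :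
    ∃ j ∈ J, ‖a ^ (n * q) - j‖ < ρ ^ (n * q) := by
  obtain ⟨j, hj, hlt⟩ := h
  obtain ⟨x, hx⟩ : j ∣ a ^ (n * q) - (a ^ n - j) ^ q := by
    have := sub_dvd_pow_sub_pow (a ^ n) (a ^ n - j) q
    rwa [sub_sub_cancel, ← pow_mul] at this
  refine ⟨j * x, J.mul_mem_right _ hj, ?_⟩
  rw [← hx, sub_sub_cancel, pow_mul ρ]
  exact (norm_pow_le' _ hq).trans_lt (pow_lt_pow_left₀ hlt (norm_nonneg _) (by omega))

section
variable {A : Type*} [NormedCommRing A] [NormedAlgebra ℂ A]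

theorem mem_hull {J : Ideal A} {φ : characterSpace ℂ A} : φ ∈ hull J ↔ ∀ a ∈ J, φ a = 0 := by
  simp [hull, zeroSet]

theorem mem_hull_iff_le {J : Ideal A} {φ : characterSpace ℂ A} :
    φ ∈ hull J ↔ J ≤ RingHom.ker φ := mem_hull

theorem continuous_eval (a : A) : Continuous fun φ : characterSpace ℂ A => φ a :=
  (gelfandTransform ℂ A a).continuous

theorem isClosed_hull (J : Ideal A) : IsClosed (hull J) :=
  isClosed_biInter fun a _ => isClosed_eq (continuous_eval a) continuous_const

theorem mem_hull_sup_span {J : Ideal A} {f : A} {w : ℂ} {φ : characterSpace ℂ A} :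
    φ ∈ hull (J ⊔ Ideal.span {f - algebraMap ℂ A w}) ↔ φ ∈ hull J ∧ φ f = w := by
  rw [mem_hull_iff_le, sup_le_iff, ← mem_hull_iff_le, Ideal.span_singleton_le_iff_mem,
    RingHom.mem_ker, map_sub, AlgHomClass.commutes, sub_eq_zero]
  rfl

instance (J : Ideal A) : IsClosed (J.closure : Set A) := by
  rw [Ideal.coe_closure]; exact isClosed_closure

theorem closure_le_ker {J : Ideal A} {φ : characterSpace ℂ A} (hφ : φ ∈ hull J) :
    ∀ a ∈ J.closure, φ a = 0 := by
  have : closure (J : Set A) ⊆ {a | φ a = 0} :=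
    closure_minimal (mem_hull.1 hφ) (isClosed_eq (map_continuous φ) continuous_const)
  intro a ha
  exact this ha

variable [CompleteSpace A]

theorem exists_mem_hull_of_quotient {J : Ideal A} (ψ : characterSpace ℂ (A ⧸ J.closure)) :
    ∃ φ ∈ hull J, ∀ a, ψ (Ideal.Quotient.mk _ a) = φ a := by
  refine ⟨CharacterSpace.equivAlgHom.symm
    ((CharacterSpace.equivAlgHom ψ).comp (Ideal.Quotient.mkₐ ℂ J.closure)), ?_, fun a => ?_⟩
  · refine mem_hull.2 fun a ha => ?_
    have : Ideal.Quotient.mk J.closure a = 0 :=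
      Ideal.Quotient.eq_zero_iff_mem.2 (subset_closure ha)
    simp [this]
  · simp

theorem exists_quotient_of_mem_hull {J : Ideal A} {φ : characterSpace ℂ A} (hφ : φ ∈ hull J) :
    ∃ ψ : characterSpace ℂ (A ⧸ J.closure), ∀ a, ψ (Ideal.Quotient.mk _ a) = φ a := by
  refine ⟨CharacterSpace.equivAlgHom.symm
    (Ideal.Quotient.liftₐ J.closure (CharacterSpace.equivAlgHom φ) fun a ha => ?_), fun a => ?_⟩
  · simpa using closure_le_ker hφ a ha
  · rw [CharacterSpace.equivAlgHom_symm_coe]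
    exact Ideal.Quotient.lift_mk _ _ _

/-- Spectral radius formula in `A ⧸ J.closure`, whose characters come from the hull. Density then
puts `j` in `J` itself, not just in its closure. -/
theorem exists_norm_pow_sub_lt {J : Ideal A} {a : A} {ρ : ℝ} (hρ : 0 < ρ)
    (h : ∀ φ ∈ hull J, ‖φ a‖ < ρ) : ∃ n : ℕ, 1 ≤ n ∧ ∃ j ∈ J, ‖a ^ n - j‖ < ρ ^ n := by
  set q := Ideal.Quotient.mk J.closure a with hq
  lift ρ to NNReal using hρ.le
  have hsr : spectralRadius ℂ q < ρ := by
    rcases subsingleton_or_nontrivial (A ⧸ J.closure) with hs | hs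
    · rw [spectrum.SpectralRadius.of_subsingleton]
      exact_mod_cast hρ
    · refine spectrum.spectralRadius_lt_of_forall_lt q fun z hz => ?_
      obtain ⟨ψ, rfl⟩ := CharacterSpace.mem_spectrum_iff_exists.1 hz
      obtain ⟨φ, hφ, hψ⟩ := exists_mem_hull_of_quotient ψ
      rw [hq, hψ]
      exact_mod_cast h φ hφ
  obtain ⟨n, hn, hn1⟩ := (((spectrum.pow_nnnorm_pow_one_div_tendsto_nhds_spectralRadius
    q).eventually (gt_mem_nhds hsr)).and (eventually_ge_atTop 1)).exists
  have hn0 : (0 : ℝ) < n := by exact_mod_cast hn1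
  have hlt : ‖q ^ n‖ < ρ ^ n := by
    have := ENNReal.rpow_lt_rpow hn hn0
    rw [← ENNReal.rpow_mul, one_div_mul_cancel hn0.ne', ENNReal.rpow_one,
      ENNReal.rpow_natCast] at this
    exact_mod_cast this
  obtain ⟨r, hr, hrn⟩ := Ideal.Quotient.norm_mk_lt (q ^ n) (sub_pos.2 hlt)
  have hmem : a ^ n - r ∈ J.closure := by
    rw [← Ideal.Quotient.eq_zero_iff_mem, map_sub, hr, map_pow, sub_self]
  obtain ⟨j, hj, hjd⟩ := Metric.mem_closure_iff.1 (show a ^ n - r ∈ closure (J : Set A) from hmem)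
    (ρ ^ n - ‖r‖) (by linarith)
  refine ⟨n, hn1, j, hj, ?_⟩
  rw [dist_eq_norm] at hjd
  calc ‖a ^ n - j‖ = ‖(a ^ n - r - j) + r‖ := by congr 1; abel
    _ ≤ ‖a ^ n - r - j‖ + ‖r‖ := norm_add_le _ _
    _ < _ := by linarith

/-- The bad points of the hull form a compact set, whose image under `f` is closed and omits `w`. -/
theorem eventually_approx {J : Ideal A} {σ : characterSpace ℂ A → ℂ}
    (hσ : ContinuousOn σ (hull J)) {f a : A} {ε : ℝ} {w : ℂ}
    (h : ∀ φ ∈ hull J, φ f = w → ‖φ a - σ φ‖ < ε) :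
    ∀ᶠ w' in 𝓝 w, ∀ φ ∈ hull J, φ f = w' → ‖φ a - σ φ‖ < ε := by
  have hT : IsClosed (hull J ∩ (fun φ => ‖φ a - σ φ‖) ⁻¹' Ici ε) :=
    (((continuous_eval a).continuousOn.sub hσ).norm).preimage_isClosed_of_isClosed
      (isClosed_hull J) isClosed_Ici
  have himg := (hT.isCompact.image (continuous_eval f)).isClosed
  have hw : w ∉ (fun φ : characterSpace ℂ A => φ f) ''
      (hull J ∩ (fun φ => ‖φ a - σ φ‖) ⁻¹' Ici ε) := by
    rintro ⟨φ, ⟨hφ, hφ'⟩, rfl⟩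
    exact not_lt.2 hφ' (h φ hφ rfl)
  filter_upwards [himg.isOpen_compl.mem_nhds hw] with w' hw' φ hφ hfw
  by_contra hlt
  exact hw' ⟨φ, ⟨hφ, not_lt.1 hlt⟩, hfw⟩

/-- If `i + k * (f - w)` works at `w`, the same `i`, `k` and `n` work nearby; compactness finishes,
exponents of two pieces being combined by multiplication. -/
theorem exists_uniform_norm_pow_sub_lt {J : Ideal A} {f : A} {u : ℂ → A} (hu : Continuous u)
    {ρ : ℝ} (hρ : 0 < ρ) (h : ∀ φ ∈ hull J, ‖φ (u (φ f))‖ < ρ) {K : Set ℂ} (hK : IsCompact K) :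
    ∃ n : ℕ, 1 ≤ n ∧ ∀ w ∈ K,
      ∃ j ∈ J ⊔ Ideal.span {f - algebraMap ℂ A w}, ‖u w ^ n - j‖ < ρ ^ n := by
  refine hK.induction_on (p := fun K => ∃ n : ℕ, 1 ≤ n ∧ ∀ w ∈ K,
      ∃ j ∈ J ⊔ Ideal.span {f - algebraMap ℂ A w}, ‖u w ^ n - j‖ < ρ ^ n)
    ⟨1, le_rfl, by simp⟩ (fun s t hst ⟨n, hn, ht⟩ => ⟨n, hn, fun w hw => ht w (hst hw)⟩) ?_ ?_
  · rintro s t ⟨n, hn, hs⟩ ⟨m, hm, ht⟩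
    refine ⟨n * m, Nat.mul_pos hn hm, ?_⟩
    rintro w (hw | hw)
    · exact exists_norm_pow_mul_sub_lt (hs w hw) hm
    · rw [mul_comm]
      exact exists_norm_pow_mul_sub_lt (ht w hw) hn
  · intro w _
    obtain ⟨n, hn, j, hj, hlt⟩ := exists_norm_pow_sub_lt
      (J := J ⊔ Ideal.span {f - algebraMap ℂ A w}) (a := u w) hρ fun φ hφ => by
        obtain ⟨hφJ, hφw⟩ := mem_hull_sup_span.1 hφ
        rw [← hφw]
        exact h φ hφJ
    obtain ⟨i, hi, y, hy, rfl⟩ := Submodule.mem_sup.1 hj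
    obtain ⟨k, rfl⟩ := Ideal.mem_span_singleton'.1 hy
    have hev : ∀ᶠ w' in 𝓝 w, ‖u w' ^ n - (i + k * (f - algebraMap ℂ A w'))‖ < ρ ^ n := by
      have hc : Continuous fun w' => ‖u w' ^ n - (i + k * (f - algebraMap ℂ A w'))‖ := by
        have := continuous_algebraMap ℂ A
        fun_prop
      exact hc.continuousAt.eventually (gt_mem_nhds hlt)
    refine ⟨_, mem_nhdsWithin_of_mem_nhds hev, n, hn, fun w' hw' => ⟨_, ?_, hw'⟩⟩
    exact Submodule.add_mem_sup hi (Ideal.mem_span_singleton'.2 ⟨k, rfl⟩)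

end

/-! ### Gluing approximants over the level sets of one element. -/

section
variable {A : Type*} [NormedCommRing A] [NormedAlgebra ℂ A]

theorem exists_smooth_approx [CompleteSpace A] {J : Ideal A} {σ : characterSpace ℂ A → ℂ}
    (hσ : ContinuousOn σ (hull J)) {f : A} {ε : ℝ}
    (H : ∀ w : ℂ, ∃ a, ∀ φ ∈ hull J, φ f = w → ‖φ a - σ φ‖ < ε) :
    ∃ g : ℂ → A, ContDiff ℝ 1 g ∧ ∀ φ ∈ hull J, ‖φ (g (φ f)) - σ φ‖ < ε := by
  have hconv : ∀ w : ℂ, Convex ℝ {a : A | ∀ φ ∈ hull J, φ f = w → ‖φ a - σ φ‖ < ε} := by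
    intro w a ha b hb s t hs ht hst φ hφ hw
    have := (convex_ball (σ φ) ε) (mem_ball_iff_norm.2 (ha φ hφ hw))
      (mem_ball_iff_norm.2 (hb φ hφ hw)) hs ht hst
    rw [mem_ball_iff_norm] at this
    rw [← Complex.coe_smul s, ← Complex.coe_smul t, map_add, map_smul, map_smul]
    simpa only [Complex.real_smul, smul_eq_mul] using this
  obtain ⟨g, hg⟩ := exists_contMDiffMap_forall_mem_convex_of_local_const (modelWithCornersSelf ℝ ℂ)
    (n := 1) hconv fun w => (H w).imp fun a ha => eventually_approx hσ ha
  exact ⟨g, g.contMDiff.contDiff, fun φ hφ => hg (φ f) φ hφ rfl⟩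

/-- The admissible multipliers form a convex set and a constant one works locally, so a partition of
unity selects them continuously. -/
theorem exists_continuous_approx_mul {J : Ideal A} {f : A} {v : ℂ → A} (hv : Continuous v) {δ : ℝ}
    (H : ∀ w, ∃ j ∈ J ⊔ Ideal.span {f - algebraMap ℂ A w}, ‖v w - j‖ < δ) :
    ∃ m : ℂ → A, Continuous m ∧
      ∀ w, ∃ j ∈ J, ‖v w - (j + m w * (f - algebraMap ℂ A w))‖ < δ := by
  have hconv : ∀ w : ℂ,
      Convex ℝ {k : A | ∃ j ∈ J, ‖v w - (j + k * (f - algebraMap ℂ A w))‖ < δ} := by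
    rintro w k ⟨i, hi, hk⟩ l ⟨j, hj, hl⟩ s t hs ht hst
    refine ⟨s • i + t • j, ?_, ?_⟩
    · rw [Algebra.smul_def, Algebra.smul_def]
      exact J.add_mem (J.mul_mem_left _ hi) (J.mul_mem_left _ hj)
    · have := (convex_ball (0 : A) δ) (mem_ball_zero_iff.2 hk) (mem_ball_zero_iff.2 hl) hs ht hst
      rw [mem_ball_zero_iff] at this
      have e : s • (v w - (i + k * (f - algebraMap ℂ A w)))
            + t • (v w - (j + l * (f - algebraMap ℂ A w)))
          = v w - (s • i + t • j + (s • k + t • l) * (f - algebraMap ℂ A w)) := by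
        rw [smul_sub, smul_sub, smul_add, smul_add, add_mul, smul_mul_assoc, smul_mul_assoc]
        conv_rhs => rw [← one_smul ℝ (v w), ← hst, add_smul]
        abel
      rwa [e] at this
  have hloc : ∀ w : ℂ, ∃ k : A, ∀ᶠ w' in 𝓝 w,
      k ∈ {k : A | ∃ j ∈ J, ‖v w' - (j + k * (f - algebraMap ℂ A w'))‖ < δ} := by
    intro w
    obtain ⟨j, hj, hlt⟩ := H w
    obtain ⟨i, hi, y, hy, rfl⟩ := Submodule.mem_sup.1 hj
    obtain ⟨k, rfl⟩ := Ideal.mem_span_singleton'.1 hy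
    have hc : Continuous fun w' => ‖v w' - (i + k * (f - algebraMap ℂ A w'))‖ := by
      have := continuous_algebraMap ℂ A
      fun_prop
    refine ⟨k, ?_⟩
    filter_upwards [hc.continuousAt.eventually (gt_mem_nhds hlt)] with w' hw'
    exact ⟨i, hi, hw'⟩
  obtain ⟨m, hm⟩ := exists_continuous_forall_mem_convex_of_local_const hconv hloc
  exact ⟨m, m.continuous, hm⟩

/-- The Wirtinger derivative `∂g/∂\bar z`. -/
noncomputable def dbar {F : Type*} [NormedAddCommGroup F] [NormedSpace ℂ F] (g : ℂ → F) (w : ℂ) : F :=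
  (1 / 2 : ℂ) • (fderiv ℝ g w 1 + Complex.I • fderiv ℝ g w Complex.I)

theorem continuous_dbar {F : Type*} [NormedAddCommGroup F] [NormedSpace ℂ F] {g : ℂ → F}
    (hg : ContDiff ℝ 1 g) : Continuous (dbar g) := by
  have := hg.continuous_fderiv one_ne_zero
  unfold dbar
  fun_prop

theorem dbar_eq_zero {F : Type*} [NormedAddCommGroup F] [NormedSpace ℂ F] {g : ℂ → F} {R : ℝ}
    (hg : ∀ w, R < ‖w‖ → g w = 0) {w : ℂ} (hw : R < ‖w‖) : dbar g w = 0 := by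
  have : g =ᶠ[𝓝 w] fun _ => 0 := by
    filter_upwards [(isOpen_lt continuous_const continuous_norm).mem_nhds hw] with x hx
    exact hg x hx
  simp [dbar, this.fderiv_eq]

theorem dbar_comp {F : Type*} [NormedAddCommGroup F] [NormedSpace ℂ F] {g : ℂ → F}
    (hg : ContDiff ℝ 1 g) (L : F →L[ℂ] ℂ) {P P' : ℂ → ℂ} (hP : ∀ z, HasDerivAt P (P' z) z) (w : ℂ) :
    dbar (fun w => P (L (g w))) w = P' (L (g w)) * L (dbar g w) := by
  have h1 : HasFDerivAt (fun w => L (g w)) ((L.restrictScalars ℝ).comp (fderiv ℝ g w)) w :=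
    (L.restrictScalars ℝ).hasFDerivAt.comp w (hg.differentiable one_ne_zero w).hasFDerivAt
  have h2 := ((hP (L (g w))).hasFDerivAt.restrictScalars ℝ).comp w h1
  have e : fderiv ℝ (fun w => P (L (g w))) w = _ := h2.fderiv
  simp only [dbar, e, map_smul, map_add, smul_eq_mul]
  simp
  ring

variable [CompleteSpace A]

theorem exists_smooth_approx_support {J : Ideal A} {σ : characterSpace ℂ A → ℂ}
    (hσ : ContinuousOn σ (hull J)) {f : A} {ε : ℝ}
    (H : ∀ w : ℂ, ∃ a, ∀ φ ∈ hull J, φ f = w → ‖φ a - σ φ‖ < ε) :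
    ∃ (g : ℂ → A) (R : ℝ), ContDiff ℝ 1 g ∧ 0 < R ∧ (∀ w, R < ‖w‖ → g w = 0) ∧
      (∀ φ : characterSpace ℂ A, ‖φ f‖ ≤ R) ∧ ∀ φ ∈ hull J, ‖φ (g (φ f)) - σ φ‖ < ε := by
  obtain ⟨g₀, hg₀, hgσ₀⟩ := exists_smooth_approx hσ H
  have hR0 : 0 < ‖f‖ * ‖(1 : A)‖ + 1 := by positivity
  have hφR : ∀ φ : characterSpace ℂ A, ‖φ f‖ ≤ ‖f‖ * ‖(1 : A)‖ + 1 := fun φ =>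
    (AlgHom.norm_apply_le_self_mul_norm_one φ f).trans (by linarith)
  -- The cutoff equals 1 on a disc containing every value `φ f`.
  let b : ContDiffBump (0 : ℂ) :=
    ⟨‖f‖ * ‖(1 : A)‖ + 1, ‖f‖ * ‖(1 : A)‖ + 1 + 1, hR0, by linarith⟩
  refine ⟨fun w => b w • g₀ w, ‖f‖ * ‖(1 : A)‖ + 1 + 1, b.contDiff.smul hg₀, by linarith,
    fun w hw => ?_, fun φ => (hφR φ).trans (by linarith), fun φ hφ => ?_⟩
  · have : b w = 0 := b.zero_of_le_dist (by simpa using hw.le)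
    simp only [this, zero_smul]
  · have : b (φ f) = 1 := b.one_of_mem_closedBall (by simpa using hφR φ)
    simp only [this, one_smul]
    exact hgσ₀ φ hφ

/-- Modulo `J + (f - w)`, powers of `g - g²` are eventually below `(1/8)^N`, which beats `c ≤ 6^N`
and the bounded factor `dbar g`. `N` is a multiple of the exponent that is uniform in `w`. -/
theorem exists_flat_step_and_quotient {J : Ideal A} {f : A} {g : ℂ → A} {R : ℝ}
    (hg : ContDiff ℝ 1 g) (hg0 : ∀ w, R < ‖w‖ → g w = 0)
    (hJ : ∀ φ ∈ hull J, ‖φ (g (φ f) - g (φ f) ^ 2)‖ < 1 / 8) {δ : ℝ} (hδ : 0 < δ) :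
    ∃ (N : ℕ) (P : ℂ → ℂ) (c : ℝ) (m : ℂ → A), P 0 = 0 ∧ P 1 = 1 ∧ 0 < c ∧ c ≤ 6 ^ N ∧
      (∀ z, HasDerivAt P (c * (z - z ^ 2) ^ N) z) ∧ (3 / 4 : ℝ) ^ N < δ ∧ Continuous m ∧
      ∀ w, ∃ j ∈ J, ‖(c : ℂ) • ((g w - g w ^ 2) ^ N * dbar g w)
        - (j + m w * (f - algebraMap ℂ A w))‖ < δ := by
  have hgc := hg.continuous
  have hSc : IsCompact (Metric.closedBall (0 : ℂ) R) := isCompact_closedBall _ _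
  obtain ⟨M, hM⟩ := hSc.exists_bound_of_continuousOn (continuous_dbar hg).continuousOn
  obtain ⟨n, hn, hnS⟩ := exists_uniform_norm_pow_sub_lt (J := J) (f := f)
    (u := fun w => g w - g w ^ 2) (by fun_prop) (ρ := 1 / 8) (by norm_num) hJ hSc
  obtain ⟨q, hq⟩ := exists_pow_lt_of_lt_one (show 0 < min δ (δ / (|M| + 1)) by positivity)
    (show (3 / 4 : ℝ) < 1 by norm_num)
  have hqN : (3 / 4 : ℝ) ^ (n * (q + 1)) < min δ (δ / (|M| + 1)) :=
    (pow_le_pow_of_le_one (by norm_num) (by norm_num) (by nlinarith)).trans_lt hq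
  obtain ⟨P, c, hP0, hP1, hc, hc6, hPd⟩ := exists_flat_step (n * (q + 1))
  have hvc : Continuous fun w => (c : ℂ) • ((g w - g w ^ 2) ^ (n * (q + 1)) * dbar g w) := by
    have := continuous_dbar hg
    fun_prop
  obtain ⟨m, hmc, hm⟩ := exists_continuous_approx_mul (J := J) (f := f) hvc (δ := δ) fun w => by
    by_cases hw : R < ‖w‖
    · exact ⟨0, zero_mem _, by simpa [dbar_eq_zero hg0 hw] using hδ⟩
    · have hw : w ∈ Metric.closedBall (0 : ℂ) R := by simpa using hw
      obtain ⟨j, hj, hlt⟩ := exists_norm_pow_mul_sub_lt (hnS w hw) (Nat.succ_pos q)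
      refine ⟨(c : ℂ) • (j * dbar g w), ?_, ?_⟩
      · rw [Algebra.smul_def]
        exact Ideal.mul_mem_left _ _ (Ideal.mul_mem_right _ _ hj)
      · rw [← smul_sub, ← sub_mul, norm_smul, Complex.norm_real, Real.norm_of_nonneg hc.le]
        calc c * ‖((g w - g w ^ 2) ^ (n * (q + 1)) - j) * dbar g w‖
            ≤ 6 ^ (n * (q + 1)) * ((1 / 8) ^ (n * (q + 1)) * |M|) := by
              refine mul_le_mul hc6 ((norm_mul_le _ _).trans ?_) (norm_nonneg _) (by positivity)
              exact mul_le_mul hlt.le ((hM w hw).trans (le_abs_self M)) (norm_nonneg _)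
                (by positivity)
          _ = (3 / 4) ^ (n * (q + 1)) * |M| := by rw [← mul_assoc, ← mul_pow]; norm_num
          _ ≤ (3 / 4) ^ (n * (q + 1)) * (|M| + 1) := by gcongr; linarith
          _ < δ := by
            rw [← lt_div_iff₀ (by positivity)]
            exact hqN.trans_le (min_le_right _ _)
  exact ⟨_, P, c, m, hP0, hP1, hc, hc6, hPd, hqN.trans_le (min_le_left _ _), hmc, hm⟩

/-- Cauchy–Pompeiu for `h = P ∘ φ ∘ g`: applying `φ` kills `j ∈ J`, leaving `∂h/∂\bar z ≈ (φ f - w)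
φ (m w)`. -/
theorem norm_character_integral_sub_le {J : Ideal A} {f : A} {g m : ℂ → A} {P P' : ℂ → ℂ}
    {R δ : ℝ} (hR : 0 < R) (hg : ContDiff ℝ 1 g) (hg0 : ∀ w, R < ‖w‖ → g w = 0)
    (hP : ∀ z, HasDerivAt P (P' z) z) (hP0 : P 0 = 0) (hm : Continuous m) {v : ℂ → A}
    {φ : characterSpace ℂ A} (hφ : φ ∈ hull J) (hφf : ‖φ f‖ ≤ R)
    (hv : ∀ w, φ (v w) = P' (φ (g w)) * φ (dbar g w))
    (hmv : ∀ w, ∃ j ∈ J, ‖v w - (j + m w * (f - algebraMap ℂ A w))‖ < δ) :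
    ‖P (φ (g (φ f))) - φ ((Real.pi : ℂ)⁻¹ • ∫ w in Metric.closedBall 0 R, m w)‖
      ≤ δ * ‖(1 : A)‖ * (2 * (2 * R + 1)) := by
  have hδ : 0 < δ := by
    obtain ⟨j, _, h⟩ := hmv 0
    exact (norm_nonneg _).trans_lt h
  set S : Set ℂ := Metric.closedBall 0 R with hS
  have hSc : IsCompact S := isCompact_closedBall _ _
  set L : A →L[ℂ] ℂ := CharacterSpace.toCLM φ with hL
  have hφm : Continuous fun w => φ (m w) := L.continuous.comp hm
  obtain ⟨C, hC⟩ := hSc.exists_bound_of_continuousOn hφm.continuousOn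
  set F : ℂ → ℂ := S.indicator fun w => φ (m w) with hF
  set h : ℂ → ℂ := fun w => P (L (g w)) with hh
  have hPc : ContDiff ℝ 1 P := by
    have : Differentiable ℂ P := fun z => (hP z).differentiableAt
    exact this.contDiff.restrict_scalars ℝ
  have hhc : ContDiff ℝ 1 h := hPc.comp ((L.restrictScalars ℝ).contDiff.comp hg)
  have hh0 : ∀ w, R < ‖w‖ → h w = 0 := fun w hw => by
    simp only [hh]; rw [hg0 w hw, map_zero, hP0]
  have key := norm_pi_mul_sub_integral_le (h := h) (F := F) (R := R) (δ := δ * ‖(1 : A)‖)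
    (C := max C 0) (z := φ f) hhc hh0
    (hφm.stronglyMeasurable.indicator Metric.isClosed_closedBall.measurableSet)
    (fun w => by
      by_cases hw : w ∈ S
      · rw [hF, indicator_of_mem hw]; exact (hC w hw).trans (le_max_left _ _)
      · rw [hF, indicator_of_notMem hw]; simp)
    (fun w hw => indicator_of_notMem (by simpa [hS] using hw) _) hR hφf
    (fun w => by
      have e1 : 1 / 2 * (fderiv ℝ h w 1 + Complex.I * fderiv ℝ h w Complex.I) = dbar h w := rfl
      rw [e1]
      by_cases hw : w ∈ S
      · obtain ⟨j, hj, hlt⟩ := hmv w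
        have e2 : dbar h w - (φ f - w) * F w
            = φ (v w - (j + m w * (f - algebraMap ℂ A w))) := by
          rw [hF, indicator_of_mem hw, dbar_comp hg L hP]
          simp only [map_sub, map_add, map_mul, AlgHomClass.commutes, mem_hull.1 hφ j hj, hv]
          simp only [Algebra.algebraMap_self, RingHom.id_apply]
          change P' (φ (g w)) * φ (dbar g w) - _ = _
          ring
        rw [e2]
        exact (AlgHom.norm_apply_le_self_mul_norm_one φ _).trans (by gcongr)
      · rw [hF, indicator_of_notMem hw, dbar_eq_zero hh0 (by simpa [hS] using hw)]
        simpa using by positivity)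
  have hint : ∫ w, F w = φ (∫ w in S, m w) := by
    rw [hF, integral_indicator Metric.isClosed_closedBall.measurableSet]
    exact L.integral_comp_comm (hm.continuousOn.integrableOn_compact hSc)
  rw [hint] at key
  have hpi : (Real.pi : ℂ) ≠ 0 := by exact_mod_cast Real.pi_ne_zero
  have hpi0 := Real.pi_pos
  have e3 : P (φ (g (φ f))) - φ ((Real.pi : ℂ)⁻¹ • ∫ w in S, m w)
      = (Real.pi : ℂ)⁻¹ * (Real.pi * h (φ f) - φ (∫ w in S, m w)) := by
    rw [map_smul, smul_eq_mul, mul_sub, ← mul_assoc, inv_mul_cancel₀ hpi, one_mul]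
    rfl
  rw [e3, norm_mul, norm_inv, Complex.norm_real, Real.norm_of_nonneg hpi0.le]
  calc _ ≤ Real.pi⁻¹ * (δ * ‖(1 : A)‖ * (2 * Real.pi * (2 * R + 1))) := by gcongr
    _ = _ := by field_simp

/-- If a `{0, 1}`-valued function on the hull of `J` can be approximated by elements of `A` along
each level set of an element `f`, then it can be approximated on the whole hull. -/
theorem exists_approx_of_forall_level {J : Ideal A} {σ : characterSpace ℂ A → ℂ}
    (hσ : ContinuousOn σ (hull J)) (h01 : ∀ φ ∈ hull J, σ φ = 0 ∨ σ φ = 1) {f : A}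
    (H : ∀ w : ℂ, ∃ a, ∀ φ ∈ hull J, φ f = w → ‖φ a - σ φ‖ < 1 / 16) :
    ∃ a, ∀ φ ∈ hull J, ‖φ a - σ φ‖ < 1 / 16 := by
  obtain ⟨g, R, hg, hR, hg0, hφR, hgσ⟩ := exists_smooth_approx_support hσ H
  have hJ : ∀ φ ∈ hull J, ‖φ (g (φ f) - g (φ f) ^ 2)‖ < 1 / 8 := fun φ hφ => by
    have h := hgσ φ hφ
    have e : φ (g (φ f) - g (φ f) ^ 2) = (φ (g (φ f)) - σ φ) * (1 - 2 * σ φ)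
        - (φ (g (φ f)) - σ φ) * (φ (g (φ f)) - σ φ) := by
      rw [map_sub, map_pow]
      rcases h01 φ hφ with h | h <;> rw [h] <;> ring
    have h1 : ‖(1 - 2 * σ φ : ℂ)‖ = 1 := by rcases h01 φ hφ with h | h <;> rw [h] <;> norm_num
    rw [e]
    refine (norm_sub_le _ _).trans_lt ?_
    rw [norm_mul, norm_mul, h1]
    nlinarith [norm_nonneg (φ (g (φ f)) - σ φ)]
  have hD : 0 < (‖(1 : A)‖ + 1) * (2 * (2 * R + 1)) := by positivity
  -- Half of 1/16 for `P` near 0 or 1, half for the integral; `‖1‖ + 1` keeps the divisor positive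
  -- in the zero ring.
  have hδ : 0 < min (1 / 32) (1 / 32 / ((‖(1 : A)‖ + 1) * (2 * (2 * R + 1)))) := by positivity
  obtain ⟨N, P, c, m, hP0, hP1, hc, hc6, hPd, hN, hm, hmv⟩ :=
    exists_flat_step_and_quotient hg hg0 hJ hδ
  refine ⟨(Real.pi : ℂ)⁻¹ • ∫ w in Metric.closedBall 0 R, m w, fun φ hφ => ?_⟩
  have h1 := norm_character_integral_sub_le hR hg hg0 hPd hP0 hm hφ (hφR φ)
    (fun w => by
      simp only [map_smul, map_mul, map_pow, map_sub, smul_eq_mul]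
      ring) hmv
  have h2 : ‖P (φ (g (φ f))) - σ φ‖ ≤ (3 / 4) ^ N :=
    norm_step_le hc hc6 hPd (by rcases h01 φ hφ with h | h <;> rw [h] <;> assumption)
      (h01 φ hφ) (hgσ φ hφ)
  have h3 : min (1 / 32) (1 / 32 / ((‖(1 : A)‖ + 1) * (2 * (2 * R + 1)))) * ‖(1 : A)‖
      * (2 * (2 * R + 1)) ≤ 1 / 32 := by
    rw [mul_assoc]
    calc _ ≤ 1 / 32 / ((‖(1 : A)‖ + 1) * (2 * (2 * R + 1)))
          * ((‖(1 : A)‖ + 1) * (2 * (2 * R + 1))) := by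
          gcongr
          · exact min_le_right _ _
          · linarith
      _ = 1 / 32 := div_mul_cancel₀ _ hD.ne'
  have h4 := hN.trans_le (min_le_left _ _)
  have h5 := norm_sub_le_norm_sub_add_norm_sub
    (φ ((Real.pi : ℂ)⁻¹ • ∫ w in Metric.closedBall 0 R, m w)) (P (φ (g (φ f)))) (σ φ)
  rw [norm_sub_rev] at h1
  linarith

end

/-! ### Zorn's lemma and the idempotent theorem. -/

section
variable {A : Type*} [NormedCommRing A] [NormedAlgebra ℂ A]

theorem hull_anti {I J : Ideal A} (h : I ≤ J) : hull J ⊆ hull I := fun _ hφ =>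
  mem_hull.2 fun a ha => mem_hull.1 hφ a (h ha)

theorem mem_hull_sSup {c : Set (Ideal A)} {φ : characterSpace ℂ A} :
    φ ∈ hull (sSup c) ↔ ∀ J ∈ c, φ ∈ hull J := by
  simp only [mem_hull_iff_le, sSup_le_iff]

variable [CompleteSpace A]

/-- The bad set is compact and the hulls along the chain are nested, so if their intersection misses
it, one of them does. -/
theorem exists_approx_of_sSup {I : Ideal A} {σ : characterSpace ℂ A → ℂ}
    (hσ : ContinuousOn σ (hull I)) {ε : ℝ} {c : Set (Ideal A)} (hcI : ∀ J ∈ c, I ≤ J)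
    (hc : IsChain (· ≤ ·) c) (hne : c.Nonempty) {a : A}
    (ha : ∀ φ ∈ hull (sSup c), ‖φ a - σ φ‖ < ε) :
    ∃ J ∈ c, ∀ φ ∈ hull J, ‖φ a - σ φ‖ < ε := by
  have hT : IsClosed (hull I ∩ (fun φ => ‖φ a - σ φ‖) ⁻¹' Ici ε) :=
    (((continuous_eval a).continuousOn.sub hσ).norm).preimage_isClosed_of_isClosed
      (isClosed_hull I) isClosed_Ici
  have : Nonempty c := hne.to_subtype
  obtain ⟨⟨J, hJ⟩, hJT⟩ := hT.isCompact.elim_directed_family_closed (fun J : c => hull J.1)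
    (fun J => isClosed_hull _) (by
      refine eq_empty_of_forall_notMem fun φ hφ => not_lt.2 hφ.1.2 (ha φ ?_)
      exact mem_hull_sSup.2 fun J hJ => mem_iInter.1 hφ.2 ⟨J, hJ⟩) (by
      rintro ⟨J, hJ⟩ ⟨K, hK⟩
      rcases hc.total hJ hK with h | h
      · exact ⟨⟨K, hK⟩, hull_anti h, subset_rfl⟩
      · exact ⟨⟨J, hJ⟩, subset_rfl, hull_anti h⟩)
  refine ⟨J, hJ, fun φ hφ => ?_⟩
  by_contra hlt
  exact (eq_empty_iff_forall_notMem.1 hJT φ) ⟨⟨hull_anti (hcI J hJ) hφ, not_lt.1 hlt⟩, hφ⟩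

theorem exists_approx {I : Ideal A} {σ : characterSpace ℂ A → ℂ}
    (hσ : ContinuousOn σ (hull I)) (h01 : ∀ φ ∈ hull I, σ φ = 0 ∨ σ φ = 1) :
    ∃ a, ∀ φ ∈ hull I, ‖φ a - σ φ‖ < 1 / 16 := by
  by_contra hI
  obtain ⟨J, hIJ, hJmax⟩ := zorn_le_nonempty₀
    {J : Ideal A | I ≤ J ∧ ¬∃ a, ∀ φ ∈ hull J, ‖φ a - σ φ‖ < 1 / 16}
    (fun c hcS hc J hJ => ⟨sSup c, ⟨(hcS hJ).1.trans (le_sSup hJ), fun ⟨a, ha⟩ => by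
      obtain ⟨K, hK, haK⟩ := exists_approx_of_sSup hσ (fun J hJ => (hcS hJ).1) hc ⟨J, hJ⟩ ha
      exact (hcS hK).2 ⟨a, haK⟩⟩, fun K hK => le_sSup hK⟩) I ⟨le_rfl, hI⟩
  have hJ := hJmax.prop.2
  by_cases hf : ∃ f : A, ∀ w : ℂ, f - algebraMap ℂ A w ∉ J
  · obtain ⟨f, hf⟩ := hf
    refine hJ (exists_approx_of_forall_level (f := f) (hσ.mono (hull_anti hIJ))
      (fun φ hφ => h01 φ (hull_anti hIJ hφ)) fun w => ?_)
    by_contra hw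
    refine hf w (hJmax.le_of_ge (y := J ⊔ Ideal.span {f - algebraMap ℂ A w})
      ⟨hIJ.trans le_sup_left, fun ⟨a, ha⟩ => hw ⟨a, fun φ hφ hφw => ?_⟩⟩ le_sup_left
      (Ideal.mem_sup_right (Ideal.mem_span_singleton_self _)))
    exact ha φ (mem_hull_sup_span.2 ⟨hφ, hφw⟩)
  · push Not at hf
    refine hJ ?_
    rcases (hull J).eq_empty_or_nonempty with he | ⟨φ₀, hφ₀⟩
    · exact ⟨0, by simp [he]⟩
    · refine ⟨algebraMap ℂ A (σ φ₀), fun φ hφ => ?_⟩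
      have : φ = φ₀ := by
        ext f
        obtain ⟨w, hw⟩ := hf f
        have h := fun {ψ : characterSpace ℂ A} (hψ : ψ ∈ hull J) => mem_hull.1 hψ _ hw
        have h1 := h hφ
        have h2 := h hφ₀
        rw [map_sub, AlgHomClass.commutes, sub_eq_zero] at h1 h2
        exact h1.trans h2.symm
      rw [this, AlgHomClass.commutes]
      simp

/-- A form of the Shilov idempotent theorem: the characteristic function of a relatively clopen
subset of a hull-kernel closed set is the restriction of a Gelfand transform. -/
theorem exists_gelfand_eq_of_continuousOn {I : Ideal A} {σ : characterSpace ℂ A → ℂ}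
    (hσ : ContinuousOn σ (hull I)) (h01 : ∀ φ ∈ hull I, σ φ = 0 ∨ σ φ = 1) :
    ∃ a, ∀ φ ∈ hull I, φ a = σ φ := by
  obtain ⟨a, ha⟩ := exists_approx hσ h01
  set q := Ideal.Quotient.mk I.closure a with hq
  -- The spectrum of `q` lies within 1/16 of 0 or 1, so this circle separates the two clusters.
  have hres : ∀ z ∈ Metric.sphere (1 : ℂ) (1 / 2), z ∈ resolventSet ℂ q := by
    intro z hz
    by_contra hzs
    obtain ⟨ψ, rfl⟩ := CharacterSpace.mem_spectrum_iff_exists.1 (show z ∈ spectrum ℂ q from hzs)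
    obtain ⟨φ, hφ, hψ⟩ := exists_mem_hull_of_quotient ψ
    rw [hq, hψ, mem_sphere_iff_norm] at hz
    have h := ha φ hφ
    rcases h01 φ hφ with h0 | h0 <;> rw [h0] at h
    · have := norm_sub_norm_le (1 : ℂ) (φ a)
      rw [norm_sub_rev, hz, norm_one] at this
      rw [sub_zero] at h
      linarith
    · linarith
  have hcont : ContinuousOn (resolvent q) (Metric.sphere (1 : ℂ) (1 / 2)) := fun z hz =>
    (spectrum.hasDerivAt_resolvent_const_left (hres z hz)).continuousAt.continuousWithinAt
  obtain ⟨b, hb⟩ := Ideal.Quotient.mk_surjective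
    ((2 * Real.pi * Complex.I : ℂ)⁻¹ • ∮ z in C(1, 1 / 2), resolvent q z)
  refine ⟨b, fun φ hφ => ?_⟩
  obtain ⟨ψ, hψ⟩ := exists_quotient_of_mem_hull hφ
  have hpi : (2 * Real.pi * Complex.I : ℂ) ≠ 0 := Complex.two_pi_I_ne_zero
  have hcomm : ψ (∮ z in C(1, 1 / 2), resolvent q z) = ∮ z in C(1, 1 / 2), (z - φ a)⁻¹ := by
    have h1 := ((CharacterSpace.toCLM ψ).intervalIntegral_comp_comm
      (hcont.circleIntegrable (by norm_num)).out)
    rw [circleIntegral]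
    refine Eq.trans h1.symm ?_
    rw [circleIntegral]
    refine intervalIntegral.integral_congr fun θ _ => ?_
    have hz := hres _ (circleMap_mem_sphere 1 (by norm_num : (0 : ℝ) ≤ 1 / 2) θ)
    set z := circleMap 1 (1 / 2) θ
    have h2 : ψ (resolvent q z) * (z - φ a) = 1 := by
      rw [← hψ, ← hq]
      have : ψ (algebraMap ℂ _ z - q) = z - ψ q := by
        rw [map_sub, AlgHomClass.commutes]; rfl
      rw [← this, ← map_mul, resolvent, Ring.inverse_mul_cancel _ hz, map_one]
    change ψ (deriv (circleMap 1 (1 / 2)) θ • resolvent q z) = _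
    rw [map_smul, eq_inv_of_mul_eq_one_left h2]
  rw [← hψ, hb, map_smul, hcomm, smul_eq_mul]
  have h := ha φ hφ
  rcases h01 φ hφ with h0 | h0 <;> rw [h0] at h ⊢
  · rw [DiffContOnCl.circleIntegral_eq_zero (by norm_num), mul_zero]
    refine DifferentiableOn.diffContOnCl fun z hz => ?_
    rw [closure_ball _ (by norm_num), mem_closedBall_iff_norm] at hz
    have : z - φ a ≠ 0 := fun h' => by
      rw [sub_eq_zero] at h'
      have := norm_sub_norm_le (1 : ℂ) (φ a)
      rw [norm_sub_rev, ← h', norm_one] at this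
      rw [sub_zero, ← h'] at h
      linarith
    have hd : DifferentiableAt ℂ (fun z => (z - φ a)⁻¹) z := by fun_prop (disch := assumption)
    exact hd.differentiableWithinAt
  · rw [circleIntegral.integral_sub_inv_of_mem_ball, inv_mul_cancel₀ hpi]
    rw [mem_ball_iff_norm]
    linarith

end

end BanachFunctionAlgebra

/-! ### Connectedness. -/

theorem mainTheorem8 {A : Type*} [NormedCommRing A] [NormedAlgebra ℂ A] [CompleteSpace A]
    (hA : Ring.jacobson A = ⊥) (E : Set (WeakDual.characterSpace ℂ A))
    (hclosed : BanachFunctionAlgebra.IsHullKernelClosed E)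
    (hanalytic : BanachFunctionAlgebra.IsTAnalytic E) :
    IsPreconnected E := by
  classical
  intro u v hu hv huv hEu hEv
  by_contra hne
  have hdisj : ∀ φ ∈ E, φ ∈ u → φ ∉ v := fun φ hφ h1 h2 => hne ⟨φ, hφ, h1, h2⟩
  set σ : WeakDual.characterSpace ℂ A → ℂ := u.indicator 1 with hσ
  have hσc : ContinuousOn σ E := by
    intro φ hφ
    rcases huv hφ with h | h
    · refine (continuousWithinAt_const (b := (1 : ℂ))).congr_of_eventuallyEq ?_ (by simp [hσ, h])
      filter_upwards [mem_nhdsWithin_of_mem_nhds (hu.mem_nhds h)] with ψ hψ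
      simp [hσ, hψ]
    · refine (continuousWithinAt_const (b := (0 : ℂ))).congr_of_eventuallyEq ?_ ?_
      · filter_upwards [mem_nhdsWithin_of_mem_nhds (hv.mem_nhds h), self_mem_nhdsWithin]
          with ψ hψ hψE
        exact indicator_of_notMem (fun h' => hdisj ψ hψE h' hψ) _
      · exact indicator_of_notMem (fun h' => hdisj φ hφ h' h) _
  have hσ01 : ∀ φ ∈ E, σ φ = 0 ∨ σ φ = 1 := fun φ _ => by
    by_cases h : φ ∈ u <;> simp [hσ, h]
  have hE : E = BanachFunctionAlgebra.hull (BanachFunctionAlgebra.kernel E) := hclosed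
  rw [hE] at hσc hσ01
  obtain ⟨a, ha⟩ := BanachFunctionAlgebra.exists_gelfand_eq_of_continuousOn hσc hσ01
  rw [← hE] at ha
  obtain ⟨φ, hφE, hφu⟩ := hEu
  obtain ⟨ψ, hψE, hψv⟩ := hEv
  -- `a` is 0 on the piece in `v`, so analyticity forces it to be 0 at `φ ∈ u`, where it is 1.
  have h0 := hanalytic a (v ∩ E) ⟨v, hv, rfl⟩ ⟨ψ, hψv, hψE⟩ (fun χ hχ => by
    rw [WeakDual.gelfandTransform_apply_apply, ha χ hχ.2]
    exact indicator_of_notMem (fun h' => hdisj χ hχ.2 h' hχ.1) _) φ hφE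
  rw [WeakDual.gelfandTransform_apply_apply, ha φ hφE] at h0
  simp [hσ, hφu] at h0
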